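/- Let $d_D,d_T\ge 1$, let $D\subset\mathbb R^{d_D}$ be compact and convex, and let $\mathcal T\subset\mathbb R^{d_T}$ be compact and convex with positive Lebesgue measure. Let $k$ be a covariance kernel (symmetric, positive semidefinite) on $D\times\mathcal T$, and suppose that $C,\alpha_1,\alpha_2>0$ are such that for all $x,x'\in D$ and $t,t'\in\mathcal T$ $$k\big((x,t),(x,t)\big)+k\big((x',t'),(x',t')\big)-2k\big((x,t),(x',t')\big)\le C\max\big(\|x-x'\|_\infty^{\alpha_1},\|t-t'\|_\infty^{\alpha_2}\big).$$ Then for every $0<\delta<\alpha_1/2$ there is a constant $K_\delta>0$ such that for every separable centred Gaussian process $Z=(Z_{x,t})_{(x,t)\in D\times\mathcal T}$ with covariance kernel $k$, on any probability space, and for all $x,x'\in D$, the quantity $\sup_{t\in\mathcal T}|Z_{x,t}-Z_{x',t}|\in[0,\infty]$ is measurable up to a null set and $$\mathbb E\Big[\sup_{t\in\mathcal T}|Z_{x,t}-Z_{x',t}|\Big]\le K_\delta\,\|x-x'\|_\infty^{\alpha_1/2-\delta}.$$ Here a real random field $(Z_s)_{s\in S}$ indexed by a topological space $S$ is called separable if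 there are a countable dense set $Q\subset S$ and a null event $N$ such that, for every open $E\subset S$ and every closed $B\subset\mathbb R$, the sets $\{Z_s\in B\ \forall s\in E\}$ and $\{Z_s\in B\ \forall s\in E\cap Q\}$ differ only by a subset of $N$. -/

import Mathlib

open MeasureTheory ProbabilityTheory
open scoped ENNReal

/-- A covariance kernel on a set `S`: symmetric, and
`∑ i, ∑ j, c i * k i j * c j ≥ 0` for all finitely supported `c : S → ℝ`. -/
def IsCovarianceKernel {S : Type*} (k : S → S → ℝ) : Prop :=
  (Matrix.of k).PosSemidef

/-- The square of the canonical semi-distance associated to a kernel. -/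
def canonicalSqDist {S : Type*} (k : S → S → ℝ) (s s' : S) : ℝ :=
  k s s + k s' s' - 2 * k s s'

/-- The Hölder-type condition on a kernel on `D × T`, with constant `C` and exponents `α₁` (over `D`)
and `α₂` (over `T`). The norm of `Fin n → ℝ` is the sup norm. -/
structure HolderKernelCondition {dD dT : ℕ} {D : Set (Fin dD → ℝ)} {T : Set (Fin dT → ℝ)}
    (k : D × T → D × T → ℝ) (C α₁ α₂ : ℝ) : Prop where
  C_pos : 0 < C
  α₁_pos : 0 < α₁
  α₂_pos : 0 < α₂
  bound : ∀ (x x' : D) (t t' : T),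
    canonicalSqDist k (x, t) (x', t') ≤
      C * max (‖(x : Fin dD → ℝ) - x'‖ ^ α₁) (‖(t : Fin dT → ℝ) - t'‖ ^ α₂)

/-- `Z ∼ GP(0, k)`: a Gaussian process with zero mean and covariance function `k`. -/
structure IsCenteredGP {S Ω : Type*} [MeasurableSpace Ω] (Z : S → Ω → ℝ) (k : S → S → ℝ)
    (P : Measure Ω) : Prop where
  isGaussian : IsGaussianProcess Z P
  mean_zero : ∀ s, ∫ ω, Z s ω ∂P = 0
  cov_eq : ∀ s s', cov[Z s, Z s'; P] = k s s'

/-- Separability of a real random field indexed by a topological space `S`: for some countable dense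
`Q ⊆ S` and some null set `N`, for all open `E ⊆ S` and closed `B ⊆ ℝ` the events
`{Z s ∈ B for all s ∈ E}` and `{Z s ∈ B for all s ∈ E ∩ Q}` differ only inside `N`. -/
def IsSeparableField {S Ω : Type*} [TopologicalSpace S] [MeasurableSpace Ω] (Z : S → Ω → ℝ)
    (P : Measure Ω) : Prop :=
  ∃ Q : Set S, Q.Countable ∧ Dense Q ∧ ∃ N : Set Ω, MeasurableSet N ∧ P N = 0 ∧
    ∀ (E : Set S) (B : Set ℝ), IsOpen E → IsClosed B →
      symmDiff {ω | ∀ s ∈ E, Z s ω ∈ B} {ω | ∀ s ∈ E ∩ Q, Z s ω ∈ B} ⊆ N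

/-- The sup norm `‖f‖_∞ ∈ [0, ∞]` of a real function, over all points of its domain. -/
noncomputable def supENorm {T : Type*} (f : T → ℝ) : ℝ≥0∞ := ⨆ t, ‖f t‖ₑ

/-!
The loss of `δ` in the exponent allows a proof by chaining with moments of high order alone.

Fix `x, x'` and put `h = ‖x - x'‖ ^ (α₁ / 2)`. The increments `Y t = Z (x, t) - Z (x', t)` have
standard deviation `O(h)`, and `Y t - Y t'` has standard deviation `O(min (h, ‖t - t'‖ ^ β))` with
`β = min α₁ α₂ / 2`, hence `O(h ^ η * ‖t - t'‖ ^ (β * (1 - η)))` for every `η ∈ [0, 1]`. Gaussian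
moments of each order `p` are bounded by powers of the standard deviation
(`IsCenteredGP.eLpNorm_sub`), so `Y / h ^ η` satisfies a Kolmogorov condition with constants that do
not depend on `x, x'`. As `p` may be taken arbitrarily large, chaining along dyadic grids
(`exists_chaining_bound`) bounds the expected supremum over a countable set of `t` by `K * h ^ η`,
and `η = 1 - 2 * δ / α₁ < 1` gives the required exponent.

The supremum over all `t` is reduced to a countable one by path continuity
(`IsSeparableField.ae_uniformContinuous`). The separant is a dense set of `D × T` and may miss the
fibres over `x` and `x'`, so continuity is needed on all of `D × T`. It follows from the same
estimate, `exists_pair_bound`, which is therefore stated for an arbitrary countable set of pairs of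
indices: the pairs `((x, t), (x', t))` give the bound, and the pairs of points of the separant at
distance at most `1 / (n + 1)` give the modulus of continuity.
-/

open scoped NNReal

universe u v

/-! ### Chaining with moments -/

/-- A maximum of finitely many variables is dominated by their `ℓᵖ` norm, so its mean grows at
most like the `p`-th root of their number. -/
lemma lintegral_iSup_finset_enorm_le {κ Ω : Type*} [MeasurableSpace Ω] {P : Measure Ω}
    [IsProbabilityMeasure P] (G : Finset κ) {Y : κ → Ω → ℝ} (hY : ∀ g, AEMeasurable (Y g) P)
    {p : ℝ≥0} (hp : 1 ≤ p) {L : ℝ≥0∞} (hL : ∀ g ∈ G, eLpNorm (Y g) p P ≤ L) :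
    ∫⁻ ω, ⨆ g ∈ G, ‖Y g ω‖ₑ ∂P ≤ (G.card : ℝ≥0∞) ^ (1 / (p : ℝ)) * L := by
  have hp0 : (0 : ℝ) < p := by exact_mod_cast zero_lt_one.trans_le hp
  have hmeas : AEMeasurable (fun ω => ⨆ g ∈ G, ‖Y g ω‖ₑ) P :=
    AEMeasurable.biSup _ G.countable_toSet fun g _ => (hY g).enorm
  have h1 := eLpNorm'_le_eLpNorm'_of_exponent_le (p := 1) (q := p) zero_lt_one
    (by exact_mod_cast hp) P hmeas.aestronglyMeasurable
  simp only [eLpNorm', enorm_eq_self, ENNReal.rpow_one, div_one] at h1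
  refine h1.trans ?_
  have h2 : ∫⁻ ω, (⨆ g ∈ G, ‖Y g ω‖ₑ) ^ (p : ℝ) ∂P ≤ G.card * L ^ (p : ℝ) := by
    calc ∫⁻ ω, (⨆ g ∈ G, ‖Y g ω‖ₑ) ^ (p : ℝ) ∂P
        ≤ ∫⁻ ω, ∑ g ∈ G, ‖Y g ω‖ₑ ^ (p : ℝ) ∂P := by
          refine lintegral_mono fun ω => ?_
          rw [← ENNReal.le_rpow_inv_iff hp0]
          refine iSup₂_le fun g hg => ?_
          rw [ENNReal.le_rpow_inv_iff hp0]
          exact Finset.single_le_sum (f := fun g => ‖Y g ω‖ₑ ^ (p : ℝ)) (fun _ _ => zero_le) hg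
      _ = ∑ g ∈ G, ∫⁻ ω, ‖Y g ω‖ₑ ^ (p : ℝ) ∂P :=
          lintegral_finsetSum' _ fun g _ => (hY g).enorm.pow_const _
      _ ≤ ∑ g ∈ G, L ^ (p : ℝ) := by
          refine Finset.sum_le_sum fun g hg => ?_
          have h3 := hL g hg
          rw [eLpNorm_eq_lintegral_rpow_enorm_toReal (by exact_mod_cast hp0.ne') (by simp)] at h3
          simp only [ENNReal.coe_toReal, one_div] at h3
          rwa [ENNReal.rpow_inv_le_iff hp0] at h3
      _ = _ := by simp
  calc (∫⁻ ω, (⨆ g ∈ G, ‖Y g ω‖ₑ) ^ (p : ℝ) ∂P) ^ (1 / (p : ℝ))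
      ≤ (G.card * L ^ (p : ℝ)) ^ (1 / (p : ℝ)) := by gcongr
    _ = _ := by
      rw [ENNReal.mul_rpow_of_nonneg _ _ (by positivity), ← ENNReal.rpow_mul,
        mul_one_div_cancel hp0.ne', ENNReal.rpow_one]

lemma lintegral_enorm_le_eLpNorm {Ω : Type*} [MeasurableSpace Ω] {P : Measure Ω}
    [IsProbabilityMeasure P] {Y : Ω → ℝ} (hY : AEMeasurable Y P) {p : ℝ≥0} (hp : 1 ≤ p) :
    ∫⁻ ω, ‖Y ω‖ₑ ∂P ≤ eLpNorm Y p P := by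
  rw [← eLpNorm_one_eq_lintegral_enorm]
  exact eLpNorm_le_eLpNorm_of_exponent_le (by exact_mod_cast hp) hY.aestronglyMeasurable

/-- Chaining: telescope `X s - X s₀` along the approximations `c n s` of `s`, and bound the
supremum of each link by the maximum over the finitely many pairs `(c (n + 1) s, c n s)`. The crude
count `N (n + 1) * N n` of these pairs suffices because `p` may be chosen large. -/
lemma lintegral_iSup_enorm_sub_le_tsum {S Ω : Type*} [Countable S] [MeasurableSpace Ω]
    {P : Measure Ω} [IsProbabilityMeasure P] {X : S → Ω → ℝ} (hX : ∀ s, AEMeasurable (X s) P)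
    {p : ℝ≥0} (hp : 1 ≤ p) {c : ℕ → S → S} {s₀ : S} (hc0 : ∀ s, c 0 s = s₀)
    {N : ℕ → ℕ} (hfin : ∀ n, (Set.range (c n)).Finite) (hN : ∀ n, (Set.range (c n)).ncard ≤ N n)
    {L : ℕ → ℝ≥0∞} (hstep : ∀ n s, eLpNorm (X (c (n + 1) s) - X (c n s)) p P ≤ L n)
    {L' : ℕ → ℝ≥0∞} (hlim : ∀ n s, eLpNorm (X s - X (c n s)) p P ≤ L' n)
    (hL' : Filter.Tendsto L' Filter.atTop (nhds 0)) :
    ∫⁻ ω, ⨆ s, ‖X s ω - X s₀ ω‖ₑ ∂P ≤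
      ∑' n, ((N (n + 1) * N n : ℕ) : ℝ≥0∞) ^ (1 / (p : ℝ)) * L n := by
  classical
  have hGfin : ∀ n, (Set.range fun s => (c (n + 1) s, c n s)).Finite := fun n =>
    ((hfin (n + 1)).prod (hfin n)).subset (by rintro _ ⟨s, rfl⟩; simp)
  set G : ℕ → Finset (S × S) := fun n => (hGfin n).toFinset with hG
  have hGcard : ∀ n, (G n).card ≤ N (n + 1) * N n := by
    intro n
    rw [← Set.ncard_eq_toFinset_card _ (hGfin n)]
    calc _ ≤ (Set.range (c (n + 1)) ×ˢ Set.range (c n)).ncard :=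
          Set.ncard_le_ncard (by rintro _ ⟨s, rfl⟩; simp) ((hfin (n + 1)).prod (hfin n))
      _ = _ := Set.ncard_prod
      _ ≤ _ := Nat.mul_le_mul (hN _) (hN _)
  set V : ℕ → Ω → ℝ≥0∞ := fun n ω => ⨆ g ∈ G n, ‖(X g.1 - X g.2) ω‖ₑ with hV
  have hVmeas : ∀ n, AEMeasurable (V n) P := fun n =>
    AEMeasurable.biSup _ (G n).countable_toSet fun g _ => ((hX g.1).sub (hX g.2)).enorm
  have hVint : ∀ n, ∫⁻ ω, V n ω ∂P ≤
      ((N (n + 1) * N n : ℕ) : ℝ≥0∞) ^ (1 / (p : ℝ)) * L n := by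
    intro n
    refine (lintegral_iSup_finset_enorm_le (G n) (Y := fun g => X g.1 - X g.2)
      (fun g => (hX g.1).sub (hX g.2)) hp (L := L n) ?_).trans ?_
    · intro g hg
      obtain ⟨s, rfl⟩ := (Set.Finite.mem_toFinset _).1 hg
      exact hstep n s
    · gcongr
      exact hGcard n
  have hVle : ∀ n s ω, ‖X (c (n + 1) s) ω - X (c n s) ω‖ₑ ≤ V n ω := fun n s ω =>
    le_iSup₂_of_le (f := fun (g : S × S) (_ : g ∈ G n) => ‖(X g.1 - X g.2) ω‖ₑ)
      (c (n + 1) s, c n s) ((hGfin n).mem_toFinset.2 ⟨s, rfl⟩) le_rfl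
  have hsum : ∀ n s ω, ‖X (c n s) ω - X s₀ ω‖ₑ ≤ ∑ i ∈ Finset.range n, V i ω := by
    intro n s ω
    induction n with
    | zero => simp [hc0]
    | succ n ih =>
      rw [Finset.sum_range_succ, add_comm (∑ i ∈ _, _)]
      calc _ = ‖(X (c (n + 1) s) ω - X (c n s) ω) + (X (c n s) ω - X s₀ ω)‖ₑ := by
            congr 1; ring
        _ ≤ _ := (enorm_add_le _ _).trans (add_le_add (hVle n s ω) ih)
  -- The infimum over `n` of the approximation errors is measurable and has mean zero.
  have hinf : ∀ s, ∀ᵐ ω ∂P, ⨅ n, ‖X s ω - X (c n s) ω‖ₑ = 0 := by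
    intro s
    have hm : ∀ n, AEMeasurable (fun ω => ‖X s ω - X (c n s) ω‖ₑ) P := fun n =>
      ((hX s).sub (hX _)).enorm
    have h0 : ∫⁻ ω, ⨅ n, ‖X s ω - X (c n s) ω‖ₑ ∂P = 0 := by
      refine le_antisymm (ge_of_tendsto' hL' fun n => ?_) zero_le
      exact (lintegral_mono fun ω => iInf_le _ n).trans
        ((lintegral_enorm_le_eLpNorm ((hX s).sub (hX (c n s))) hp).trans (hlim n s))
    rwa [lintegral_eq_zero_iff' (AEMeasurable.iInf hm)] at h0
  calc ∫⁻ ω, ⨆ s, ‖X s ω - X s₀ ω‖ₑ ∂P ≤ ∫⁻ ω, ∑' n, V n ω ∂P := by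
        refine lintegral_mono_ae ?_
        filter_upwards [ae_all_iff.2 hinf] with ω hω
        refine iSup_le fun s => ENNReal.le_of_forall_pos_le_add fun ε hε _ => ?_
        obtain ⟨n, hn⟩ := iInf_lt_iff.1 ((hω s).trans_lt (ENNReal.coe_pos.2 hε))
        calc _ = ‖(X (c n s) ω - X s₀ ω) + (X s ω - X (c n s) ω)‖ₑ := by congr 1; ring
          _ ≤ _ := enorm_add_le _ _
          _ ≤ _ := add_le_add ((hsum n s ω).trans (ENNReal.sum_le_tsum _)) hn.le
    _ = ∑' n, ∫⁻ ω, V n ω ∂P := lintegral_tsum hVmeas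
    _ ≤ _ := ENNReal.tsum_le_tsum hVint

/-! ### Grid approximations in a cube -/

/-- A set embedded isometrically (for the sup norm) in the cube `[-R, R]^ι` has approximation maps
at scale `2⁻ⁿ` with `O(2 ^ n) ^ card ι` values: `c n s` is a chosen point whose coordinates
round down to the same multiples of `2⁻ⁿ` as those of `s`. Level `0` is constant, to serve as the
start of a chain. -/
lemma exists_grid_approx {S ι : Type*} [PseudoMetricSpace S] [Fintype ι] {e : S → ι → ℝ}
    (he : Isometry e) {R : ℕ} (hR : ∀ s i, |e s i| ≤ R) (s₀ : S) :
    ∃ c : ℕ → S → S, (∀ s, c 0 s = s₀) ∧ (∀ n, (Set.range (c n)).Finite) ∧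
      (∀ n, (Set.range (c n)).ncard ≤ ((2 * R + 1) * 2 ^ n) ^ Fintype.card ι) ∧
      ∀ n s, dist s (c n s) ≤ (2 * R + 1) / 2 ^ n := by
  classical
  have : Nonempty S := ⟨s₀⟩
  let g : ℕ → S → ι → ℤ := fun n s i => ⌊2 ^ n * e s i⌋
  let F : ℕ → Finset (ι → ℤ) := fun n =>
    Fintype.piFinset fun _ => Finset.Icc (-((R : ℤ) * 2 ^ n)) (R * 2 ^ n)
  have hgF : ∀ n s, g n s ∈ F n := by
    intro n s
    refine Fintype.mem_piFinset.2 fun i => Finset.mem_Icc.2 ?_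
    have h1 := abs_le.1 (hR s i)
    have h2 : (0 : ℝ) < 2 ^ n := by positivity
    constructor
    · refine Int.le_floor.2 ?_
      push_cast
      nlinarith
    · have : (⌊2 ^ n * e s i⌋ : ℝ) ≤ ((R * 2 ^ n : ℤ) : ℝ) := by
        refine (Int.floor_le _).trans ?_
        push_cast
        nlinarith
      exact Int.cast_le.1 this
  have hFcard : ∀ n, (F n).card ≤ ((2 * R + 1) * 2 ^ n) ^ Fintype.card ι := by
    intro n
    simp only [F, Fintype.card_piFinset, Finset.prod_const, Finset.card_univ, Int.card_Icc]
    refine Nat.pow_le_pow_left ?_ _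
    have h1 : ((R : ℤ) * 2 ^ n + 1 - -((R : ℤ) * 2 ^ n)).toNat = 2 * (R * 2 ^ n) + 1 := by
      have : (R : ℤ) * 2 ^ n = ((R * 2 ^ n : ℕ) : ℤ) := by push_cast; ring
      rw [this]; omega
    rw [h1]
    nlinarith [Nat.one_le_two_pow (n := n)]
  let c : ℕ → S → S := fun n => if n = 0 then fun _ => s₀ else Function.invFun (g n) ∘ g n
  have hrange : ∀ n, ∃ f : (ι → ℤ) → S, Set.range (c n) ⊆ f '' (F n : Set (ι → ℤ)) := by
    intro n
    by_cases hn : n = 0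
    · refine ⟨fun _ => s₀, ?_⟩
      rintro _ ⟨s, rfl⟩
      exact ⟨g n s, hgF n s, by simp [c, hn]⟩
    · refine ⟨Function.invFun (g n), ?_⟩
      rintro _ ⟨s, rfl⟩
      exact ⟨g n s, hgF n s, by simp [c, hn]⟩
  refine ⟨c, fun s => by simp [c], fun n => ?_, fun n => ?_, fun n s => ?_⟩
  · obtain ⟨f, hf⟩ := hrange n
    exact ((F n).finite_toSet.image f).subset hf
  · obtain ⟨f, hf⟩ := hrange n
    calc _ ≤ (f '' (F n : Set (ι → ℤ))).ncard :=
          Set.ncard_le_ncard hf ((F n).finite_toSet.image f)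
      _ ≤ (F n : Set (ι → ℤ)).ncard := Set.ncard_image_le (F n).finite_toSet
      _ = (F n).card := Set.ncard_coe_finset _
      _ ≤ _ := hFcard n
  · rw [← he.dist_eq]
    refine (dist_pi_le_iff (by positivity)).2 fun i => ?_
    rw [Real.dist_eq]
    by_cases hn : n = 0
    · subst hn
      calc _ ≤ |e s i| + |e (c 0 s) i| := abs_sub _ _
        _ ≤ _ := by linarith [hR s i, hR (c 0 s) i]
    · have h1 : g n (c n s) = g n s := by
        simp only [c, hn, if_false, Function.comp]
        exact Function.invFun_eq ⟨s, rfl⟩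
      have h2 := Int.abs_sub_lt_one_of_floor_eq_floor (congrFun h1 i).symm
      rw [← mul_sub, abs_mul, abs_of_nonneg (by positivity)] at h2
      rw [le_div_iff₀ (by positivity)]
      have : (0 : ℝ) ≤ R := by positivity
      linarith

/-- The chaining series converges once `4 * m ≤ p * β`: the entropy factor `2 ^ (2 * m * n / p)` is
then at most `2 ^ (β * n / 2)`, against the decay `2 ^ (-β * n)` of the increments. -/
lemma tsum_chaining_ne_top (m R : ℕ) {β : ℝ} (hβ : 0 < β) {p : ℝ≥0} (hp : 1 ≤ p)
    (hpm : 4 * m ≤ p * β) {r : ℝ≥0∞} (hr : r ≠ ⊤) :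
    ∑' n : ℕ, ((((R * 2 ^ (n + 1)) ^ m * (R * 2 ^ n) ^ m : ℕ)) : ℝ≥0∞) ^ (1 / (p : ℝ)) *
      (r * 2 ^ (-(n : ℝ))) ^ β ≠ ⊤ := by
  have hp0 : (0 : ℝ) < p := by exact_mod_cast zero_lt_one.trans_le hp
  set B : ℝ≥0∞ := ((2 * R ^ 2) ^ m : ℝ≥0∞) ^ (1 / (p : ℝ)) * r ^ β with hB
  have hBtop : B ≠ ⊤ := ENNReal.mul_ne_top
    (ENNReal.rpow_ne_top_of_nonneg (by positivity) (by finiteness))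
    (ENNReal.rpow_ne_top_of_nonneg hβ.le hr)
  have hq : (2 : ℝ≥0∞) ^ (-(β / 2)) < 1 :=
    ENNReal.rpow_lt_one_of_one_lt_of_neg (by norm_num) (by linarith)
  refine ne_top_of_le_ne_top (b := ∑' n : ℕ, B * ((2 : ℝ≥0∞) ^ (-(β / 2))) ^ n) ?_ ?_
  · rw [ENNReal.tsum_mul_left, ENNReal.tsum_geometric]
    exact ENNReal.mul_ne_top hBtop (ENNReal.inv_ne_top.2 (tsub_pos_of_lt hq).ne')
  · refine ENNReal.tsum_le_tsum fun n => ?_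
    have h2 : (2 : ℝ≥0∞) ^ ((2 * m * n : ℕ) / (p : ℝ)) ≤ 2 ^ (β / 2 * n) := by
      refine ENNReal.rpow_le_rpow_of_exponent_le (by norm_num) ?_
      rw [div_le_iff₀ hp0]
      push_cast
      nlinarith [(Nat.cast_nonneg n : (0 : ℝ) ≤ n)]
    have h1 : ((((R * 2 ^ (n + 1)) ^ m * (R * 2 ^ n) ^ m : ℕ)) : ℝ≥0∞) ^ (1 / (p : ℝ)) ≤
        ((2 * R ^ 2) ^ m : ℝ≥0∞) ^ (1 / (p : ℝ)) * 2 ^ (β / 2 * n) := by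
      have : ((((R * 2 ^ (n + 1)) ^ m * (R * 2 ^ n) ^ m : ℕ)) : ℝ≥0∞) =
          (2 * R ^ 2) ^ m * 2 ^ (2 * m * n) := by
        push_cast; ring
      rw [this, ENNReal.mul_rpow_of_nonneg _ _ (by positivity),
        ← ENNReal.rpow_natCast 2 (2 * m * n), ← ENNReal.rpow_mul, mul_one_div]
      gcongr
    calc _ ≤ (((2 * R ^ 2) ^ m : ℝ≥0∞) ^ (1 / (p : ℝ)) * 2 ^ (β / 2 * n)) *
          (r ^ β * 2 ^ (-(n : ℝ) * β)) := by
          rw [ENNReal.mul_rpow_of_nonneg _ _ hβ.le, ← ENNReal.rpow_mul]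
          gcongr
      _ = B * (2 ^ (β / 2 * n) * 2 ^ (-(n : ℝ) * β)) := by rw [hB]; ring
      _ = _ := by
          rw [← ENNReal.rpow_add _ _ (by norm_num) (by norm_num), ← ENNReal.rpow_mul_natCast]
          congr 2; ring

/-- Kolmogorov-type moment bound: if the increments of a field over a bounded part of `ℝ^ι` are
`β`-Hölder in `Lᵖ` with constant `M`, and `p` is large, then the expected supremum of
`|X s - X s₀|` is at most `K * M`, where `K` depends only on the dimension, the radius `R`, `β`
and `p`. -/
lemma exists_chaining_bound (m R : ℕ) {β : ℝ} (hβ : 0 < β) {p : ℝ≥0} (hp : 1 ≤ p)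
    (hpm : 4 * m ≤ p * β) :
    ∃ K : ℝ≥0∞, K ≠ ⊤ ∧ ∀ {S : Type u} {Ω : Type v} {ι : Type} [Fintype ι]
      [PseudoMetricSpace S] [Countable S] [MeasurableSpace Ω] {P : Measure Ω}
      [IsProbabilityMeasure P] {e : S → ι → ℝ} {X : S → Ω → ℝ} {M : ℝ≥0∞},
      Fintype.card ι = m → Isometry e → (∀ s i, |e s i| ≤ R) → (∀ s, AEMeasurable (X s) P) →
      M ≠ ⊤ → (∀ s t, eLpNorm (X s - X t) p P ≤ M * edist s t ^ β) →
      ∀ s₀, ∫⁻ ω, ⨆ s, ‖X s ω - X s₀ ω‖ₑ ∂P ≤ K * M := by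
  refine ⟨_, tsum_chaining_ne_top m (2 * R + 1) hβ hp hpm (r := 2 * (2 * R + 1 : ℕ))
    (by finiteness), ?_⟩
  intro S Ω ι _ _ _ _ P _ e X M hm he hR hX hM hXM s₀
  obtain ⟨c, hc0, hfin, hcard, hdist⟩ := exists_grid_approx he hR s₀
  rw [hm] at hcard
  have hedist : ∀ n s, edist s (c n s) ≤ (2 * R + 1 : ℕ) * 2 ^ (-(n : ℝ)) := by
    intro n s
    rw [edist_dist]
    refine (ENNReal.ofReal_le_ofReal (hdist n s)).trans ?_
    rw [ENNReal.rpow_neg, ENNReal.rpow_natCast, ENNReal.ofReal_div_of_pos (by positivity),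
      ENNReal.ofReal_pow (by norm_num), ← div_eq_mul_inv]
    refine le_of_eq ?_
    congr 1
    · rw [← ENNReal.ofReal_natCast]; push_cast; rfl
    · simp
  have hedist' : ∀ n s, edist (c (n + 1) s) (c n s) ≤ 2 * (2 * R + 1 : ℕ) * 2 ^ (-(n : ℝ)) := by
    intro n s
    calc _ ≤ edist s (c (n + 1) s) + edist s (c n s) := edist_triangle_left _ _ _
      _ ≤ (2 * R + 1 : ℕ) * 2 ^ (-((n + 1 : ℕ) : ℝ)) + (2 * R + 1 : ℕ) * 2 ^ (-(n : ℝ)) :=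
          add_le_add (hedist _ _) (hedist _ _)
      _ ≤ (2 * R + 1 : ℕ) * 2 ^ (-(n : ℝ)) + (2 * R + 1 : ℕ) * 2 ^ (-(n : ℝ)) := by
          gcongr
          · norm_num
          · omega
      _ = _ := by ring
  refine (lintegral_iSup_enorm_sub_le_tsum hX hp hc0 hfin hcard
    (L := fun n => M * (2 * (2 * R + 1 : ℕ) * 2 ^ (-(n : ℝ))) ^ β)
    (fun n s => (hXM _ _).trans (by gcongr; exact hedist' n s))
    (L' := fun n => M * ((2 * R + 1 : ℕ) * 2 ^ (-(n : ℝ))) ^ β)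
    (fun n s => (hXM _ _).trans (by gcongr; exact hedist n s)) ?_).trans ?_
  · have h1 : Filter.Tendsto (fun n : ℕ => (2 : ℝ≥0∞) ^ (-(n : ℝ))) Filter.atTop (nhds 0) := by
      have := ENNReal.tendsto_pow_atTop_nhds_zero_of_lt_one (r := 2⁻¹) (by norm_num)
      refine this.congr fun n => ?_
      rw [ENNReal.rpow_neg, ENNReal.rpow_natCast, ENNReal.inv_pow]
    have h2 := ENNReal.Tendsto.const_mul (a := ((2 * R + 1 : ℕ) : ℝ≥0∞)) h1
      (Or.inr (by finiteness))
    have h3 := (h2.ennrpow_const β)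
    have h4 := ENNReal.Tendsto.const_mul (a := M) h3 (Or.inr hM)
    simpa [ENNReal.zero_rpow_of_pos hβ] using h4
  · rw [← ENNReal.tsum_mul_right]
    refine ENNReal.tsum_le_tsum fun n => le_of_eq ?_
    ring

/-! ### Suprema over sets of small increments -/

/-- The product with its max metric embeds isometrically in the concatenated coordinates. -/
lemma Isometry.sumElim {S S' ι ι' : Type*} [PseudoMetricSpace S] [PseudoMetricSpace S'] [Fintype ι]
    [Fintype ι'] {e : S → ι → ℝ} {e' : S' → ι' → ℝ} (he : Isometry e) (he' : Isometry e') :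
    Isometry fun a : S × S' => (Sum.elim (e a.1) (e' a.2) : ι ⊕ ι' → ℝ) := by
  refine Isometry.of_dist_eq fun a b => le_antisymm ?_ ?_
  · refine (dist_pi_le_iff dist_nonneg).2 ?_
    rintro (i | i)
    · exact (dist_le_pi_dist _ _ i).trans ((he.dist_eq _ _).trans_le (le_max_left _ _))
    · exact (dist_le_pi_dist _ _ i).trans ((he'.dist_eq _ _).trans_le (le_max_right _ _))
  · refine max_le ?_ ?_
    · rw [← he.dist_eq]
      exact (dist_pi_le_iff dist_nonneg).2 fun i => dist_le_pi_dist
        (Sum.elim (e a.1) (e' a.2)) (Sum.elim (e b.1) (e' b.2)) (Sum.inl i)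
    · rw [← he'.dist_eq]
      exact (dist_pi_le_iff dist_nonneg).2 fun i => dist_le_pi_dist
        (Sum.elim (e a.1) (e' a.2)) (Sum.elim (e b.1) (e' b.2)) (Sum.inr i)

/-- Interpolation for a double increment: it is at most `2 * h` when read as a difference of two
small increments, at most `2 * d` when regrouped, and `min h d ≤ h ^ η * d ^ (1 - η)`. -/
lemma eLpNorm_sub_sub_sub_le {Ω : Type*} [MeasurableSpace Ω] {P : Measure Ω} {f₁ f₂ g₁ g₂ : Ω → ℝ}
    (hf₁ : AEMeasurable f₁ P) (hf₂ : AEMeasurable f₂ P) (hg₁ : AEMeasurable g₁ P)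
    (hg₂ : AEMeasurable g₂ P) {p : ℝ≥0∞} (hp : 1 ≤ p) {h d : ℝ≥0∞} {η : ℝ} (hη0 : 0 ≤ η)
    (hη1 : η ≤ 1) (hf : eLpNorm (f₁ - f₂) p P ≤ h) (hg : eLpNorm (g₁ - g₂) p P ≤ h)
    (h₁ : eLpNorm (f₁ - g₁) p P ≤ d) (h₂ : eLpNorm (f₂ - g₂) p P ≤ d) :
    eLpNorm ((f₁ - f₂) - (g₁ - g₂)) p P ≤ 2 * (h ^ η * d ^ (1 - η)) := by
  have key : ∀ x : ℝ≥0∞, x ≤ h + h → x ≤ d + d → x ≤ 2 * (h ^ η * d ^ (1 - η)) := by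
    intro x hx hx'
    have hmin : min h d ≤ h ^ η * d ^ (1 - η) := by
      calc min h d = min h d ^ η * min h d ^ (1 - η) := by
            rw [← ENNReal.rpow_add_of_nonneg _ _ hη0 (by linarith), add_sub_cancel,
              ENNReal.rpow_one]
        _ ≤ _ := by
            gcongr
            · exact min_le_left _ _
            · exact min_le_right _ _
    calc x ≤ 2 * min h d := by
          rcases min_choice h d with H | H <;> rw [H, two_mul] <;> assumption
      _ ≤ _ := by gcongr
  refine key _ ?_ ?_
  · exact (eLpNorm_sub_le (hf₁.sub hf₂).aestronglyMeasurable
      (hg₁.sub hg₂).aestronglyMeasurable hp).trans (add_le_add hf hg)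
  · have : (f₁ - f₂) - (g₁ - g₂) = (f₁ - g₁) - (f₂ - g₂) := by abel
    rw [this]
    exact (eLpNorm_sub_le (hf₁.sub hg₁).aestronglyMeasurable
      (hf₂.sub hg₂).aestronglyMeasurable hp).trans (add_le_add h₁ h₂)

/-- If the increments of `X` along a countable set `A` of pairs have `Lᵖ` norm at most `h`, the
expected supremum of these increments is at most `K * h ^ η`, for any `η < 1` and with `K`
independent of `A` and `h`. The field `a ↦ X a.1 - X a.2` over pairs is Hölder with a constant
proportional to `h ^ η` by interpolation, which allows chaining over pairs. -/
lemma exists_pair_bound {S : Type u} [PseudoMetricSpace S] {ι : Type} [Fintype ι]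
    {e : S → ι → ℝ} (he : Isometry e) {R : ℕ} (hR : ∀ s i, |e s i| ≤ R) {β η : ℝ} (hβ : 0 < β)
    (hη0 : 0 ≤ η) (hη1 : η < 1) {p : ℝ≥0} (hp : 1 ≤ p)
    (hpm : 4 * ((Fintype.card ι + Fintype.card ι : ℕ) : ℝ) ≤ p * (β * (1 - η)))
    {L : ℝ≥0∞} (hL : L ≠ ⊤) :
    ∃ K : ℝ≥0∞, K ≠ ⊤ ∧ ∀ {Ω : Type v} [MeasurableSpace Ω] {P : Measure Ω}
      [IsProbabilityMeasure P] {X : S → Ω → ℝ}, (∀ s, AEMeasurable (X s) P) →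
      (∀ s t, eLpNorm (X s - X t) p P ≤ L * edist s t ^ β) →
      ∀ {A : Set (S × S)}, A.Countable → ∀ {h : ℝ≥0∞}, h ≠ ⊤ →
      (∀ a ∈ A, eLpNorm (X a.1 - X a.2) p P ≤ h) →
      ∫⁻ ω, ⨆ a ∈ A, ‖X a.1 ω - X a.2 ω‖ₑ ∂P ≤ K * h ^ η := by
  have hη : 0 < 1 - η := by linarith
  obtain ⟨K, hK, hbound⟩ := exists_chaining_bound.{u, v} (Fintype.card ι + Fintype.card ι) R
    (mul_pos hβ hη) hp hpm
  refine ⟨K * (2 * L ^ (1 - η)), ENNReal.mul_ne_top hK (ENNReal.mul_ne_top (by norm_num)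
    (ENNReal.rpow_ne_top_of_nonneg hη.le hL)), ?_⟩
  intro Ω _ P _ X hX hXL A hA h hh hAh
  rcases A.eq_empty_or_nonempty with rfl | ⟨⟨s₀, _⟩, _⟩
  · simp
  -- The diagonal pair `(s₀, s₀)`, where the increment vanishes, is the start of the chain.
  set B : Set (S × S) := insert (s₀, s₀) A with hB
  have hBh : ∀ a ∈ B, eLpNorm (X a.1 - X a.2) p P ≤ h := by
    rintro a (rfl | ha)
    · simp
    · exact hAh a ha
  have : Countable B := (hA.insert _).to_subtype
  have hY := hbound (S := B) (P := P) (ι := ι ⊕ ι)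
    (e := fun a => Sum.elim (e a.1.1) (e a.1.2)) (X := fun a => X a.1.1 - X a.1.2)
    (M := 2 * L ^ (1 - η) * h ^ η) (by simp)
    ((he.sumElim he).comp isometry_subtype_coe)
    (by rintro a (i | i) <;> exact hR _ _) (fun a => (hX _).sub (hX _))
    (ENNReal.mul_ne_top (ENNReal.mul_ne_top (by norm_num)
      (ENNReal.rpow_ne_top_of_nonneg hη.le hL)) (ENNReal.rpow_ne_top_of_nonneg hη0 hh))
    (fun a b => ?_) ⟨(s₀, s₀), Set.mem_insert _ _⟩
  · calc _ ≤ _ := lintegral_mono fun ω => ?_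
      _ ≤ _ := hY
      _ = _ := by ring
    refine iSup₂_le fun a ha => ?_
    refine le_iSup_of_le (⟨a, Set.mem_insert_of_mem _ ha⟩ : B) ?_
    simp
  · refine (eLpNorm_sub_sub_sub_le (hX _) (hX _) (hX _) (hX _) (by exact_mod_cast hp) hη0 hη1.le
      (hBh _ a.2) (hBh _ b.2) (d := L * edist a b ^ β) ?_ ?_).trans (le_of_eq ?_)
    · refine (hXL _ _).trans ?_
      gcongr
      exact le_max_left _ _
    · refine (hXL _ _).trans ?_
      gcongr
      exact le_max_right _ _
    · rw [ENNReal.mul_rpow_of_nonneg _ _ hη.le, ← ENNReal.rpow_mul]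
      ring

/-! ### Moments of Gaussian increments -/

lemma IsCenteredGP.variance_sub {S Ω : Type*} [MeasurableSpace Ω] {Z : S → Ω → ℝ}
    {k : S → S → ℝ} {P : Measure Ω} (hZ : IsCenteredGP Z k P) (s t : S) :
    Var[Z s - Z t; P] = canonicalSqDist k s t := by
  have := hZ.isGaussian.isProbabilityMeasure
  have hm : ∀ s, MemLp (Z s) 2 P := fun s => (hZ.isGaussian.hasGaussianLaw_eval s).memLp_two
  rw [ProbabilityTheory.variance_sub (hm s) (hm t), ← covariance_self (hm s).aemeasurable,
    ← covariance_self (hm t).aemeasurable, hZ.cov_eq, hZ.cov_eq, hZ.cov_eq, canonicalSqDist]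
  ring

lemma IsCenteredGP.canonicalSqDist_nonneg {S Ω : Type*} [MeasurableSpace Ω] {Z : S → Ω → ℝ}
    {k : S → S → ℝ} {P : Measure Ω} (hZ : IsCenteredGP Z k P) (s t : S) :
    0 ≤ canonicalSqDist k s t := hZ.variance_sub s t ▸ variance_nonneg _ _

/-- All moments of a centred Gaussian increment are governed by the canonical semi-distance: its
law is that of a standard Gaussian variable scaled by the standard deviation. -/
lemma IsCenteredGP.eLpNorm_sub {S Ω : Type*} [MeasurableSpace Ω] {Z : S → Ω → ℝ}
    {k : S → S → ℝ} {P : Measure Ω} (hZ : IsCenteredGP Z k P) (p : ℝ≥0∞) (s t : S) :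
    eLpNorm (Z s - Z t) p P =
      ENNReal.ofReal (√(canonicalSqDist k s t)) * eLpNorm id p (gaussianReal 0 1) := by
  have hlaw := (hZ.isGaussian.hasGaussianLaw_sub (s := s) (t := t))
  have hm : ∀ s, Integrable (Z s) P := fun s => (hZ.isGaussian.hasGaussianLaw_eval s).integrable
  have hmap : P.map (Z s - Z t) =
      (gaussianReal 0 1).map (√(canonicalSqDist k s t) * ·) := by
    rw [hlaw.map_eq_gaussianReal, hZ.variance_sub, gaussianReal_map_const_mul]
    congr 1
    · simp only [Pi.sub_apply]
      rw [integral_sub (hm s) (hm t), hZ.mean_zero, hZ.mean_zero]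
      simp
    · ext
      simp [Real.sq_sqrt (hZ.canonicalSqDist_nonneg s t), hZ.canonicalSqDist_nonneg s t]
  calc eLpNorm (Z s - Z t) p P = eLpNorm id p (P.map (Z s - Z t)) := by
        rw [eLpNorm_map_measure aestronglyMeasurable_id hlaw.aemeasurable]; rfl
    _ = eLpNorm (√(canonicalSqDist k s t) • id) p (gaussianReal 0 1) := by
        rw [hmap, eLpNorm_map_measure aestronglyMeasurable_id (by fun_prop)]; rfl
    _ = _ := by rw [eLpNorm_const_smul, Real.enorm_eq_ofReal (Real.sqrt_nonneg _)]

/-- On an index set of diameter at most `b`, the two exponents can be merged into their minimum,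
with respect to the max metric on `D × T`. -/
lemma HolderKernelCondition.canonicalSqDist_le {dD dT : ℕ} {D : Set (Fin dD → ℝ)}
    {T : Set (Fin dT → ℝ)} {k : D × T → D × T → ℝ} {C α₁ α₂ : ℝ}
    (hcond : HolderKernelCondition k C α₁ α₂) {b : ℝ} (hb : 1 ≤ b)
    (hdist : ∀ s s' : D × T, dist s s' ≤ b) (s s' : D × T) :
    canonicalSqDist k s s' ≤ C * b ^ (α₁ + α₂) * dist s s' ^ min α₁ α₂ := by
  have h1 := hcond.α₁_pos
  have h2 := hcond.α₂_pos
  have key : ∀ {u a : ℝ}, 0 ≤ u → u ≤ dist s s' → min α₁ α₂ ≤ a → a ≤ α₁ + α₂ →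
      u ^ a ≤ b ^ (α₁ + α₂) * dist s s' ^ min α₁ α₂ := by
    intro u a hu hus ha ha'
    have hmin : 0 < min α₁ α₂ := lt_min h1 h2
    calc u ^ a ≤ dist s s' ^ a := Real.rpow_le_rpow hu hus (by linarith)
      _ = dist s s' ^ (a - min α₁ α₂) * dist s s' ^ min α₁ α₂ := by
          rw [← Real.rpow_add_of_nonneg dist_nonneg (by linarith) hmin.le, sub_add_cancel]
      _ ≤ b ^ (a - min α₁ α₂) * dist s s' ^ min α₁ α₂ := by
          gcongr
          exact hdist s s'
      _ ≤ _ := by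
          gcongr
          linarith
  refine (hcond.bound s.1 s'.1 s.2 s'.2).trans ?_
  rw [mul_assoc]
  refine mul_le_mul_of_nonneg_left (max_le ?_ ?_) hcond.C_pos.le
  · refine key (norm_nonneg _) ?_ (min_le_left _ _) (by linarith)
    rw [← dist_eq_norm]
    exact le_max_left _ _
  · refine key (norm_nonneg _) ?_ (min_le_right _ _) (by linarith)
    rw [← dist_eq_norm]
    exact le_max_right _ _

lemma IsCenteredGP.eLpNorm_sub_le {S Ω : Type*} [MeasurableSpace Ω] {Z : S → Ω → ℝ}
    {k : S → S → ℝ} {P : Measure Ω} (hZ : IsCenteredGP Z k P) (p : ℝ≥0∞) {s t : S} {C d a : ℝ}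
    (hd : 0 ≤ d) (ha : 0 ≤ a) (h : canonicalSqDist k s t ≤ C * d ^ a) :
    eLpNorm (Z s - Z t) p P ≤
      ENNReal.ofReal (√C) * eLpNorm id p (gaussianReal 0 1) * ENNReal.ofReal d ^ (a / 2) := by
  rw [hZ.eLpNorm_sub, mul_right_comm, ENNReal.ofReal_rpow_of_nonneg hd (by linarith),
    ← ENNReal.ofReal_mul (Real.sqrt_nonneg _)]
  gcongr
  refine (Real.sqrt_le_sqrt h).trans (le_of_eq ?_)
  rw [Real.sqrt_mul' _ (by positivity), Real.sqrt_eq_rpow (d ^ a), ← Real.rpow_mul hd]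
  ring_nf

/-! ### Continuity of separable fields -/

/-- If closed constraints on a function pass from `E ∩ Q` to `E` for each open `E`, then each value
`z s` is a limit of values at points of `Q` near `s`; a modulus of continuity on `Q` therefore
extends to the whole space. -/
lemma uniformContinuous_of_separant {S : Type*} [PseudoMetricSpace S] {z : S → ℝ} {Q : Set S}
    (hsep : ∀ (E : Set S) (B : Set ℝ), IsOpen E → IsClosed B →
      (∀ s ∈ E ∩ Q, z s ∈ B) → ∀ s ∈ E, z s ∈ B)
    (hmod : ∀ ε > 0, ∃ r > 0, ∀ a ∈ Q, ∀ b ∈ Q, dist a b ≤ r → dist (z a) (z b) ≤ ε) :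
    UniformContinuous z := by
  refine Metric.uniformContinuous_iff.2 fun ε hε => ?_
  obtain ⟨r, hr, hQ⟩ := hmod (ε / 4) (by positivity)
  have happrox : ∀ s, ∃ q ∈ Q, dist s q < r / 3 ∧ dist (z s) (z q) < ε / 4 := by
    intro s
    have h := hsep (Metric.ball s (r / 3)) (closure (z '' (Metric.ball s (r / 3) ∩ Q)))
      Metric.isOpen_ball isClosed_closure (fun q hq => subset_closure ⟨q, hq, rfl⟩) s
      (Metric.mem_ball_self (by positivity))
    obtain ⟨_, ⟨q, hq, rfl⟩, hzq⟩ := Metric.mem_closure_iff.1 h (ε / 4) (by positivity)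
    exact ⟨q, hq.2, Metric.mem_ball'.1 hq.1, hzq⟩
  refine ⟨r / 3, by positivity, fun s s' hss' => ?_⟩
  obtain ⟨q, hqQ, hq, hzq⟩ := happrox s
  obtain ⟨q', hqQ', hq', hzq'⟩ := happrox s'
  have h1 : dist q q' ≤ r := by
    have := dist_triangle4_right q q' s s'
    rw [dist_comm q s, dist_comm q' s'] at this
    linarith
  have h2 := dist_triangle4_right (z s) (z s') (z q) (z q')
  linarith [hQ q hqQ q' hqQ' h1]

/-- Almost every path of a separable field whose increments are Hölder in `Lᵖ` is uniformly continuous.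
The expected oscillation at scale `1 / (n + 1)` over the countable separant tends to zero by
`exists_pair_bound`, applied to the close pairs of the separant with exponent `1 / 2`. -/
lemma IsSeparableField.ae_uniformContinuous {S : Type u} [PseudoMetricSpace S] {Ω : Type v}
    [MeasurableSpace Ω] {P : Measure Ω} [IsProbabilityMeasure P] {Z : S → Ω → ℝ}
    (hsep : IsSeparableField Z P) {ι : Type} [Fintype ι]
    {e : S → ι → ℝ} (he : Isometry e) {R : ℕ} (hR : ∀ s i, |e s i| ≤ R) {β : ℝ} (hβ : 0 < β)
    {p : ℝ≥0} (hp : 1 ≤ p)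
    (hpm : 4 * ((Fintype.card ι + Fintype.card ι : ℕ) : ℝ) ≤ p * (β * (1 - 1 / 2)))
    {L : ℝ≥0∞} (hL : L ≠ ⊤) (hZ : ∀ s, AEMeasurable (Z s) P)
    (hZL : ∀ s t, eLpNorm (Z s - Z t) p P ≤ L * edist s t ^ β) :
    ∀ᵐ ω ∂P, UniformContinuous fun s => Z s ω := by
  obtain ⟨Q, hQc, -, N, -, hN0, hN⟩ := hsep
  obtain ⟨K, hK, hbound⟩ := exists_pair_bound.{u, v} he hR hβ (η := 1 / 2) (by norm_num)
    (by norm_num) hp hpm hL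
  set A : ℕ → Set (S × S) := fun n => {a ∈ Q ×ˢ Q | dist a.1 a.2 ≤ 1 / (n + 1)} with hA
  have hAc : ∀ n, (A n).Countable := fun n => (hQc.prod hQc).mono (Set.sep_subset _ _)
  have hle : ∀ n, ∫⁻ ω, ⨆ a ∈ A n, ‖Z a.1 ω - Z a.2 ω‖ₑ ∂P ≤
      K * (L * ENNReal.ofReal (1 / (n + 1)) ^ β) ^ (1 / 2 : ℝ) := by
    intro n
    refine hbound hZ hZL (hAc n) ?_ fun a ha => (hZL _ _).trans ?_
    · exact ENNReal.mul_ne_top hL (ENNReal.rpow_ne_top_of_nonneg hβ.le ENNReal.ofReal_ne_top)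
    · gcongr
      rw [edist_dist]
      exact ENNReal.ofReal_le_ofReal ha.2
  have hlim : Filter.Tendsto
      (fun n : ℕ => K * (L * ENNReal.ofReal (1 / (n + 1)) ^ β) ^ (1 / 2 : ℝ))
      Filter.atTop (nhds 0) := by
    have h1 := ENNReal.tendsto_ofReal (tendsto_one_div_add_atTop_nhds_zero_nat (𝕜 := ℝ))
    have h2 := ENNReal.Tendsto.const_mul (a := L) (h1.ennrpow_const β) (Or.inr hL)
    have h3 := ENNReal.Tendsto.const_mul (a := K) (h2.ennrpow_const (1 / 2)) (Or.inr hK)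
    simpa [ENNReal.zero_rpow_of_pos hβ] using h3
  have hm : ∀ n, AEMeasurable (fun ω => ⨆ a ∈ A n, ‖Z a.1 ω - Z a.2 ω‖ₑ) P := fun n =>
    AEMeasurable.biSup _ (hAc n) fun a _ => ((hZ _).sub (hZ _)).enorm
  have hinf : ∀ᵐ ω ∂P, ⨅ n, ⨆ a ∈ A n, ‖Z a.1 ω - Z a.2 ω‖ₑ = 0 := by
    refine (lintegral_eq_zero_iff' (AEMeasurable.iInf hm)).1 ?_
    exact le_antisymm (ge_of_tendsto' hlim fun n =>
      (lintegral_mono fun ω => iInf_le _ n).trans (hle n)) zero_le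
  filter_upwards [hinf, measure_eq_zero_iff_ae_notMem.1 hN0] with ω hω hωN
  refine uniformContinuous_of_separant (Q := Q) (fun E B hE hB h => ?_) fun ε hε => ?_
  · by_contra hcon
    exact hωN (hN E B hE hB (Or.inr ⟨h, hcon⟩))
  · obtain ⟨n, hn⟩ := iInf_lt_iff.1 (hω.trans_lt (ENNReal.ofReal_pos.2 hε))
    refine ⟨1 / (n + 1), by positivity, fun a ha b hb hab => ?_⟩
    have h1 : ‖Z a ω - Z b ω‖ₑ ≤ ENNReal.ofReal ε :=
      (le_iSup₂_of_le (f := fun (g : S × S) (_ : g ∈ A n) => ‖Z g.1 ω - Z g.2 ω‖ₑ)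
        (a, b) ⟨⟨ha, hb⟩, hab⟩ le_rfl).trans hn.le
    rw [← edist_eq_enorm_sub, edist_dist] at h1
    exact (ENNReal.ofReal_le_ofReal_iff hε.le).1 h1

lemma supENorm_eq_biSup_of_dense {T : Type*} [TopologicalSpace T] {f : T → ℝ} (hf : Continuous f)
    {T₀ : Set T} (hT₀ : Dense T₀) : supENorm f = ⨆ t ∈ T₀, ‖f t‖ₑ := by
  refine le_antisymm (iSup_le fun t => ?_) (iSup₂_le fun t _ => le_iSup (fun t => ‖f t‖ₑ) t)
  have hclosed : IsClosed {t | ‖f t‖ₑ ≤ ⨆ t ∈ T₀, ‖f t‖ₑ} :=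
    isClosed_le hf.enorm continuous_const
  exact hclosed.closure_subset_iff.2
    (fun t ht => le_iSup₂_of_le (f := fun t (_ : t ∈ T₀) => ‖f t‖ₑ) t ht le_rfl) (hT₀ t)

/-! ### The expected supremum of an increment in `x` -/

theorem mainTheorem3 {dD dT : ℕ} (hdD : 1 ≤ dD) (hdT : 1 ≤ dT)
    (D : Set (Fin dD → ℝ)) (T : Set (Fin dT → ℝ))
    (hD_compact : IsCompact D) (hD_convex : Convex ℝ D)
    (hT_compact : IsCompact T) (hT_convex : Convex ℝ T) (hT_vol : 0 < volume T)
    (k : D × T → D × T → ℝ) (hk : IsCovarianceKernel k)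
    (C α₁ α₂ : ℝ) (hcond : HolderKernelCondition k C α₁ α₂)
    (δ : ℝ) (hδ_pos : 0 < δ) (hδ_lt : δ < α₁ / 2) :
    ∃ K : ℝ, 0 < K ∧
      ∀ (Ω : Type*) [MeasurableSpace Ω] (P : Measure Ω) [IsProbabilityMeasure P]
        (Z : D × T → Ω → ℝ), IsCenteredGP Z k P → IsSeparableField Z P →
        ∀ x x' : D,
          AEMeasurable (fun ω => supENorm (fun t : T => Z (x, t) ω - Z (x', t) ω)) P ∧
          ∫⁻ ω, supENorm (fun t : T => Z (x, t) ω - Z (x', t) ω) ∂P ≤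
            ENNReal.ofReal (K * ‖(x : Fin dD → ℝ) - x'‖ ^ (α₁ / 2 - δ)) := by
  have hα₁ := hcond.α₁_pos
  have hα₂ := hcond.α₂_pos
  set e : D × T → Fin dD ⊕ Fin dT → ℝ := fun s => Sum.elim (s.1 : Fin dD → ℝ) (s.2 : Fin dT → ℝ)
    with he_def
  have he : Isometry e := isometry_subtype_coe.sumElim isometry_subtype_coe
  obtain ⟨R, hR⟩ : ∃ R : ℕ, ∀ s i, |e s i| ≤ R := by
    obtain ⟨r₁, hr₁⟩ := hD_compact.isBounded.exists_norm_le
    obtain ⟨r₂, hr₂⟩ := hT_compact.isBounded.exists_norm_le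
    obtain ⟨R, hR⟩ := exists_nat_ge (max r₁ r₂)
    refine ⟨R, ?_⟩
    rintro ⟨x, t⟩ (i | i)
    · exact (norm_le_pi_norm (x : Fin dD → ℝ) i).trans
        ((hr₁ _ x.2).trans ((le_max_left _ _).trans hR))
    · exact (norm_le_pi_norm (t : Fin dT → ℝ) i).trans
        ((hr₂ _ t.2).trans ((le_max_right _ _).trans hR))
  have hdist : ∀ s s' : D × T, dist s s' ≤ 2 * R + 1 := by
    intro s s'
    rw [← he.dist_eq]
    refine (dist_pi_le_iff (by positivity)).2 fun i => ?_
    rw [Real.dist_eq]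
    linarith [abs_sub (e s i) (e s' i), hR s i, hR s' i]
  set C' : ℝ := C * (2 * R + 1) ^ (α₁ + α₂) with hC'
  set β : ℝ := min α₁ α₂ / 2 with hβ_def
  have hβ : 0 < β := by have := lt_min hα₁ hα₂; positivity
  -- The exponent that turns the standard deviation, of order `‖x - x'‖ ^ (α₁ / 2)`, into the rate.
  set η : ℝ := 1 - 2 * δ / α₁ with hη_def
  have hη0 : 0 < η := by
    rw [hη_def, sub_pos, div_lt_one hα₁]
    linarith
  have hη1 : η < 1 := by
    have : 0 < 2 * δ / α₁ := by positivity
    linarith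
  have hη : α₁ / 2 * η = α₁ / 2 - δ := by
    rw [hη_def]; field_simp
  -- A moment of high enough order serves both for `η` and for the exponent `1 / 2`.
  obtain ⟨p, hp, hpη, hphalf⟩ : ∃ p : ℝ≥0, 1 ≤ p ∧
      4 * ((Fintype.card (Fin dD ⊕ Fin dT) + Fintype.card (Fin dD ⊕ Fin dT) : ℕ) : ℝ) ≤
        p * (β * (1 - η)) ∧
      4 * ((Fintype.card (Fin dD ⊕ Fin dT) + Fintype.card (Fin dD ⊕ Fin dT) : ℕ) : ℝ) ≤
        p * (β * (1 - 1 / 2)) := by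
    have hpos : 0 < β * (1 - η) := mul_pos hβ (by linarith)
    have hpos' : 0 < β * (1 - 1 / 2) := mul_pos hβ (by norm_num)
    have ht := Filter.tendsto_id (α := ℝ) (x := Filter.atTop)
    obtain ⟨p, h1, h2, h3⟩ := ((Filter.eventually_ge_atTop (1 : ℝ)).and
      (((ht.atTop_mul_const hpos).eventually_ge_atTop _).and
        ((ht.atTop_mul_const hpos').eventually_ge_atTop _))).exists
    exact ⟨⟨p, by linarith⟩, h1, h2, h3⟩
  set m : ℝ≥0∞ := eLpNorm id p (gaussianReal 0 1) with hm_def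
  have hm : m ≠ ⊤ := (memLp_id_gaussianReal p).eLpNorm_ne_top
  have hL : ENNReal.ofReal (√C') * m ≠ ⊤ := ENNReal.mul_ne_top ENNReal.ofReal_ne_top hm
  have hG : ENNReal.ofReal (√C) * m ≠ ⊤ := ENNReal.mul_ne_top ENNReal.ofReal_ne_top hm
  obtain ⟨K, hK, hbound⟩ := exists_pair_bound he hR hβ hη0.le hη1 hp hpη hL
  have hKG : K * (ENNReal.ofReal (√C) * m) ^ η ≠ ⊤ :=
    ENNReal.mul_ne_top hK (ENNReal.rpow_ne_top_of_nonneg hη0.le hG)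
  refine ⟨(K * (ENNReal.ofReal (√C) * m) ^ η).toReal + 1, by positivity, ?_⟩
  intro Ω _ P _ Z hZ hsep x x'
  have hZm : ∀ s, AEMeasurable (Z s) P := fun s => hZ.isGaussian.aemeasurable s
  have hZL : ∀ s t, eLpNorm (Z s - Z t) p P ≤ ENNReal.ofReal (√C') * m * edist s t ^ β := by
    intro s t
    rw [edist_dist]
    exact hZ.eLpNorm_sub_le p dist_nonneg (lt_min hα₁ hα₂).le
      (hcond.canonicalSqDist_le (by linarith [(Nat.cast_nonneg R : (0 : ℝ) ≤ R)]) hdist s t)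
  have hcont := hsep.ae_uniformContinuous he hR hβ hp hphalf hL hZm hZL
  obtain ⟨T₀, hT₀c, hT₀⟩ := TopologicalSpace.exists_countable_dense T
  have hsup : (fun ω => supENorm (fun t : T => Z (x, t) ω - Z (x', t) ω)) =ᵐ[P]
      fun ω => ⨆ t ∈ T₀, ‖Z (x, t) ω - Z (x', t) ω‖ₑ := by
    filter_upwards [hcont] with ω hω
    have hω' := hω.continuous
    exact supENorm_eq_biSup_of_dense (by fun_prop) hT₀
  refine ⟨AEMeasurable.congr (AEMeasurable.biSup _ hT₀c fun t _ =>
    ((hZm _).sub (hZm _)).enorm) hsup.symm, ?_⟩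
  rw [lintegral_congr_ae hsup]
  set d : ℝ := ‖(x : Fin dD → ℝ) - x'‖ with hd
  have hd0 : 0 ≤ d := norm_nonneg _
  have hh : ∀ t, eLpNorm (Z (x, t) - Z (x', t)) p P ≤
      ENNReal.ofReal (√C) * m * ENNReal.ofReal d ^ (α₁ / 2) := by
    intro t
    refine hZ.eLpNorm_sub_le p hd0 hα₁.le ((hcond.bound x x' t t).trans (le_of_eq ?_))
    rw [sub_self, norm_zero, Real.zero_rpow hα₂.ne', max_eq_left (by positivity)]
  have hmain := hbound hZm hZL (A := (fun t => ((x, t), (x', t))) '' T₀) (hT₀c.image _)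
    (h := ENNReal.ofReal (√C) * m * ENNReal.ofReal d ^ (α₁ / 2))
    (ENNReal.mul_ne_top hG (ENNReal.rpow_ne_top_of_nonneg (by positivity) ENNReal.ofReal_ne_top))
    (by rintro _ ⟨t, -, rfl⟩; exact hh t)
  simp only [iSup_image] at hmain
  refine hmain.trans ?_
  rw [ENNReal.mul_rpow_of_nonneg _ _ hη0.le, ← mul_assoc, ← ENNReal.rpow_mul, hη,
    ENNReal.ofReal_mul (by positivity), ENNReal.ofReal_rpow_of_nonneg hd0 (by linarith)]
  gcongr
  rw [ENNReal.le_ofReal_iff_toReal_le hKG (by positivity)]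
  linarith
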